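/- For integers $m,k\ge 0$ let $K(m,k)$ be the Kneser graph: its vertices are the $k$-element subsets of $\{1,\dots,m\}$, and two distinct vertices are adjacent if and only if they are disjoint. For a finite graph $G$ let $\mathcal{I}^r(G)$ be the family of all independent sets of $G$ of size $r$, and for a vertex $v$ of $G$ let $\mathcal{I}^r_v(G)=\{S\in\mathcal{I}^r(G): v\in S\}$, the star centered at $v$. A family $\mathcal{A}$ of sets is intersecting if $S\cap T\neq\emptyset$ for all $S,T\in\mathcal{A}$ (including $S=T$). The family $\mathcal{I}^r(G)$ is strictly EKR if (i) every intersecting family $\mathcal{A}\subseteq\mathcal{I}^r(G)$ satisfies $|\mathcal{A}|\le\max_{v\in V(G)}|\mathcal{I}^r_v(G)|$, and (ii) every intersecting family $\mathcal{A}\subseteq\mathcal{I}^r(G)$ of maximum size equals $\mathcal{I}^r_v(G)$ for some vertex $v$. Corollary. Let $n\ge 1$ and $0\le r\le n-1$ be integers, and let $\overline{K(2n,2)}$ be the complement of the Kneser graph $K(2n,2)$. Then $\mathcal{I}^r(\overline{K(2n,2)})$ is strictly EKR. -/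

import Mathlib

/-- The Kneser graph `K(m, k)`: the vertices are the `k`-subsets of an `m`-element set, and two
distinct vertices are adjacent when they are disjoint. (Distinctness only matters for `k = 0`,
where it excludes a loop.) -/
def kneserGraph (m k : ℕ) : SimpleGraph {A : Finset (Fin m) // A.card = k} where
  Adj A B := A ≠ B ∧ Disjoint A.1 B.1
  symm := ⟨fun _ _ h => ⟨h.1.symm, h.2.symm⟩⟩
  loopless := ⟨fun _ h => h.1 rfl⟩

instance kneserGraph.decidableAdj (m k : ℕ) : DecidableRel (kneserGraph m k).Adj :=
  fun A B => inferInstanceAs (Decidable (A ≠ B ∧ Disjoint A.1 B.1))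

namespace SimpleGraph

variable {V : Type*} [Fintype V] [DecidableEq V] (G : SimpleGraph V) [DecidableRel G.Adj]

/-- The star centered at `v`: all independent sets of `G` of size `r` that contain `v`. -/
def indepStar (r : ℕ) (v : V) : Finset (Finset V) :=
  (G.indepSetFinset r).filter (fun s => v ∈ s)

/-- `A` is an intersecting family of independent sets of size `r` of `G`. -/
def IsIntersectingIndepFamily (r : ℕ) (A : Finset (Finset V)) : Prop :=
  A ⊆ G.indepSetFinset r ∧ (A : Set (Finset V)).Intersecting

/-- The family of independent `r`-sets of `G` is EKR: no intersecting subfamily is larger than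
the largest star. -/
def IndepIsEKR (r : ℕ) : Prop :=
  ∀ A : Finset (Finset V), G.IsIntersectingIndepFamily r A →
    A.card ≤ Finset.univ.sup (fun v : V => (G.indepStar r v).card)

/-- The family of independent `r`-sets of `G` is strictly EKR: it is EKR, and every intersecting
subfamily of maximum size is a star. -/
def IndepIsStrictlyEKR (r : ℕ) : Prop :=
  G.IndepIsEKR r ∧
    ∀ A : Finset (Finset V), G.IsIntersectingIndepFamily r A →
      (∀ B : Finset (Finset V), G.IsIntersectingIndepFamily r B → B.card ≤ A.card) →
      ∃ v : V, A = G.indepStar r v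

end SimpleGraph

/-! Independent sets of the complement are matchings of the complete graph on 2n = 2h + 2 points, so
Katona's cycle method applies. The rotational one-factorization lists all edges in a cycle
(`cycEdge`) in which any h consecutive edges are disjoint (`disjoint_cycEdge`). Hence under every
labelling of the points each window of r ≤ h edges is a matching. Two windows of one labelling share
an edge only if their starts are less than r apart on the cycle. So an intersecting family contains
at most r of them (`intersecting_arcs`), while a star contains at least r. Permutations act
transitively on r-matchings, and averaging over all labellings gives the bound
(`card_le_star_and_center`).

If the bound is attained, every labelling has a center: a position such that the windows in the
family are exactly those through it. Some labelling has a center i with 0 ≤ i and i + r ≤ h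
(`exists_early_center`), so the window starting at i lies in one perfect matching and leaves out its
last edge. Certain swaps of adjacent residues preserve this center (`IsCenter.trans_residueSwap`),
and conjugating them exchanges -k with -(h + 1) for any i < k ≤ h (`IsCenter.swap_last`). If a
member M missed the edge at i, such exchanges would remove one by one the edges that M shares with
the window at i, although that window stays in the family (`IsCenter.edge_mem`). So the family lies
in a star, and equals it by size. -/

/-! ### The rotational one-factorization as a cyclic sequence -/

/-- The vertices of the complete graph on `2 * (h + 1)` points: the residues modulo `2 * h + 1`
together with one point at infinity. -/
abbrev RotVertex (h : ℕ) : Type := Option (ZMod (2 * h + 1))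

/-- The finite vertex given by the residue of an integer. -/
def residue (h : ℕ) (x : ℤ) : RotVertex h := some (x : ZMod (2 * h + 1))

theorem residue_eq_iff {h : ℕ} {x y : ℤ} :
    residue h x = residue h y ↔ (2 * (h : ℤ) + 1) ∣ x - y := by
  unfold residue
  rw [Option.some_inj, eq_comm, ZMod.intCast_eq_intCast_iff_dvd_sub]
  push_cast
  rfl

theorem eq_of_dvd_sub_of_lt {m x y : ℤ} (hd : m ∣ x - y) (h1 : x - y < m) (h2 : y - x < m) :
    x = y := by
  have := Int.eq_zero_of_abs_lt_dvd hd (abs_lt.2 ⟨by omega, h1⟩)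
  omega

theorem eq_of_residue_eq {h : ℕ} {x y : ℤ} (e : residue h x = residue h y)
    (h1 : x - y < 2 * h + 1) (h2 : y - x < 2 * h + 1) : x = y :=
  eq_of_dvd_sub_of_lt (residue_eq_iff.1 e) h1 h2

/-- The `k`-th edge of the `t`-th perfect matching of the rotational one-factorization. -/
def rowEdge (h : ℕ) (t k : ℤ) : Finset (RotVertex h) :=
  {if k = 0 then none else residue h (t + k), residue h (t - k)}

/-- The cyclic sequence of all edges, listing the perfect matchings one after the other. -/
def cycEdge (h : ℕ) (q : ℤ) : Finset (RotVertex h) :=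
  rowEdge h (q / ((h : ℤ) + 1)) (q % ((h : ℤ) + 1))

theorem exists_row_coord (h : ℕ) (q : ℤ) :
    ∃ t k : ℤ, 0 ≤ k ∧ k ≤ h ∧ q = t * ((h : ℤ) + 1) + k :=
  ⟨q / ((h : ℤ) + 1), q % ((h : ℤ) + 1), Int.emod_nonneg _ (by omega),
    by have := Int.emod_lt_of_pos q (show (0 : ℤ) < h + 1 by omega); omega,
    by rw [mul_comm]; exact (Int.mul_ediv_add_emod q _).symm⟩

theorem cycEdge_row {h : ℕ} {t k : ℤ} (h0 : 0 ≤ k) (h1 : k ≤ h) :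
    cycEdge h (t * ((h : ℤ) + 1) + k) = rowEdge h t k := by
  unfold cycEdge
  have hp : (0 : ℤ) < h + 1 := by omega
  have e1 : (t * ((h : ℤ) + 1) + k) / ((h : ℤ) + 1) = t := by
    rw [add_comm, Int.add_mul_ediv_right _ _ hp.ne', Int.ediv_eq_zero_of_lt h0 (by omega)]
    omega
  have e2 : (t * ((h : ℤ) + 1) + k) % ((h : ℤ) + 1) = k := by
    rw [add_comm, Int.add_mul_emod_self_right, Int.emod_eq_of_lt h0 (by omega)]
  rw [e1, e2]

theorem cycEdge_zero_row {h : ℕ} {k : ℤ} (h0 : 0 ≤ k) (h1 : k ≤ h) :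
    cycEdge h k = rowEdge h 0 k := by
  simpa using cycEdge_row (t := 0) h0 h1

theorem residue_ne_none {h : ℕ} {x : ℤ} : residue h x ≠ none := by simp [residue]

theorem rowEdge_ends_ne {h : ℕ} {t k : ℤ} (h0 : 0 ≤ k) (h1 : k ≤ h) :
    (if k = 0 then none else residue h (t + k)) ≠ residue h (t - k) := by
  split_ifs with hk
  · exact residue_ne_none.symm
  · intro e
    have := eq_of_residue_eq e (by omega) (by omega)
    omega

theorem card_cycEdge (h : ℕ) (q : ℤ) : (cycEdge h q).card = 2 := by
  obtain ⟨t, k, h0, h1, rfl⟩ := exists_row_coord h q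
  rw [cycEdge_row h0 h1]
  exact Finset.card_pair (rowEdge_ends_ne h0 h1)

theorem disjoint_rowEdge_same {h : ℕ} {t k l : ℤ} (h0 : 0 ≤ k) (hkl : k < l) (h1 : l ≤ h) :
    Disjoint (rowEdge h t k) (rowEdge h t l) := by
  unfold rowEdge
  have hl : l ≠ 0 := by omega
  simp only [Finset.disjoint_insert_left, Finset.disjoint_singleton_left, Finset.mem_insert,
    Finset.mem_singleton, not_or, if_neg hl]
  refine ⟨⟨?_, ?_⟩, ?_, ?_⟩
  all_goals try split_ifs
  all_goals first
    | exact residue_ne_none.symm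
    | (intro e; have := eq_of_residue_eq e (by omega) (by omega); omega)

/-- For l ≤ k - 2 the finite ends of the later edge lie strictly between t - k and t + k, an
interval shorter than the modulus. For l = k - 1 both edges contain t + k, which is why only h
consecutive edges are disjoint. -/
theorem disjoint_rowEdge_succ {h : ℕ} {t k l : ℤ} (h0 : 0 ≤ l) (hkl : l + 2 ≤ k) (h1 : k ≤ h) :
    Disjoint (rowEdge h t k) (rowEdge h (t + 1) l) := by
  unfold rowEdge
  have hl : k ≠ 0 := by omega
  simp only [Finset.disjoint_insert_left, Finset.disjoint_singleton_left, Finset.mem_insert,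
    Finset.mem_singleton, not_or, if_neg hl]
  refine ⟨⟨?_, ?_⟩, ?_, ?_⟩
  all_goals try split_ifs
  all_goals first
    | exact residue_ne_none
    | (intro e; have := eq_of_residue_eq e (by omega) (by omega); omega)

/-- Any `h` consecutive edges are pairwise disjoint. -/
theorem disjoint_cycEdge {h : ℕ} {a b : ℤ} (hab : a < b) (hb : b < a + h) :
    Disjoint (cycEdge h a) (cycEdge h b) := by
  obtain ⟨t, k, h0, h1, rfl⟩ := exists_row_coord h a
  by_cases hc : k + (b - (t * ((h : ℤ) + 1) + k)) ≤ h
  · have : b = t * ((h : ℤ) + 1) + (k + (b - (t * ((h : ℤ) + 1) + k))) := by ring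
    rw [this, cycEdge_row h0 h1, cycEdge_row (by omega) hc]
    exact disjoint_rowEdge_same h0 (by omega) hc
  · have : b = (t + 1) * ((h : ℤ) + 1) + (b - (t * ((h : ℤ) + 1)) - (h + 1)) := by ring
    rw [this, cycEdge_row h0 h1, cycEdge_row (by omega) (by omega)]
    exact disjoint_rowEdge_succ (by omega) (by omega) h1

/-- For k > 0 the ends sum to 2t, and 2 is invertible modulo 2h + 1, so the edge determines its row.
Then k is determined up to sign, and 0 ≤ k ≤ h fixes it. -/
theorem rowEdge_injective {h : ℕ} {t k s l : ℤ} (hk0 : 0 ≤ k) (hk : k ≤ h) (hl0 : 0 ≤ l)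
    (hl : l ≤ h) (e : rowEdge h t k = rowEdge h s l) : (2 * (h : ℤ) + 1) ∣ t - s ∧ k = l := by
  have m1 : (if k = 0 then none else residue h (t + k)) ∈ rowEdge h s l := by
    rw [← e]; simp [rowEdge]
  have m2 : residue h (t - k) ∈ rowEdge h s l := by rw [← e]; simp [rowEdge]
  have m3 : (if l = 0 then none else residue h (s + l)) ∈ rowEdge h t k := by
    rw [e]; simp [rowEdge]
  have hne := rowEdge_ends_ne (t := t) hk0 hk
  have half : ∀ x : ℤ, (2 * (h : ℤ) + 1) ∣ 2 * x → (2 * (h : ℤ) + 1) ∣ x := fun x hx => by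
    have : x = (2 * (h : ℤ) + 1) * x - h * (2 * x) := by ring
    rw [this]
    exact dvd_sub (dvd_mul_right _ _) (dvd_mul_of_dvd_right hx _)
  by_cases k0 : k = 0 <;> by_cases l0 : l = 0
  · subst k0 l0
    simp only [rowEdge, Finset.mem_insert, Finset.mem_singleton, if_true, residue_ne_none,
      false_or, residue_eq_iff] at m2
    exact ⟨by simpa using m2, rfl⟩
  · simp [rowEdge, k0, l0, residue_ne_none.symm] at m1
  · simp [rowEdge, k0, l0, residue_ne_none.symm] at m3
  · simp only [rowEdge, Finset.mem_insert, Finset.mem_singleton, if_neg k0, if_neg l0] at m1 m2 hne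
    rcases m1 with m1 | m1 <;> rcases m2 with m2 | m2
    · exact absurd (m1.trans m2.symm) hne
    · rw [residue_eq_iff] at m1 m2
      have d1 := half (t - s) (by
        rw [show 2 * (t - s) = (t + k - (s + l)) + (t - k - (s - l)) by ring]
        exact dvd_add m1 m2)
      refine ⟨d1, eq_of_dvd_sub_of_lt (m := 2 * h + 1) ?_ (by omega) (by omega)⟩
      rw [show k - l = (t + k - (s + l)) - (t - s) by ring]
      exact dvd_sub m1 d1
    · rw [residue_eq_iff] at m1 m2
      have d1 := half (t - s) (by
        rw [show 2 * (t - s) = (t + k - (s - l)) + (t - k - (s + l)) by ring]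
        exact dvd_add m1 m2)
      have d2 : (2 * (h : ℤ) + 1) ∣ k - (-l) := by
        rw [show k - (-l) = (t + k - (s - l)) - (t - s) by ring]
        exact dvd_sub m1 d1
      have := eq_of_dvd_sub_of_lt d2 (by omega) (by omega)
      omega
    · exact absurd (m1.trans m2.symm) hne

/-- The number of edges, as an integer. -/
abbrev cycLength (h : ℕ) : ℤ := ((h : ℤ) + 1) * (2 * h + 1)

theorem dvd_of_cycEdge_eq {h : ℕ} {a b : ℤ} (e : cycEdge h a = cycEdge h b) :
    cycLength h ∣ a - b := by
  obtain ⟨t, k, h0, h1, rfl⟩ := exists_row_coord h a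
  obtain ⟨s, l, h2, h3, rfl⟩ := exists_row_coord h b
  rw [cycEdge_row h0 h1, cycEdge_row h2 h3] at e
  obtain ⟨⟨c, hc⟩, rfl⟩ := rowEdge_injective h0 h1 h2 h3 e
  exact ⟨c, by linear_combination ((h : ℤ) + 1) * hc⟩

theorem cycEdge_eq_of_dvd {h : ℕ} {a b : ℤ} (e : cycLength h ∣ a - b) :
    cycEdge h a = cycEdge h b := by
  obtain ⟨c, hc⟩ := e
  obtain ⟨s, l, h2, h3, rfl⟩ := exists_row_coord h b
  have : a = (s + (2 * h + 1) * c) * ((h : ℤ) + 1) + l := by linear_combination hc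
  rw [this, cycEdge_row h2 h3, cycEdge_row h2 h3]
  have key : ∀ x y : ℤ, x - y = (2 * h + 1) * c → residue h x = residue h y := fun x y hxy =>
    residue_eq_iff.2 ⟨c, hxy⟩
  unfold rowEdge
  rw [key (s + (2 * h + 1) * c + l) (s + l) (by ring),
    key (s + (2 * h + 1) * c - l) (s - l) (by ring)]

theorem cycLength_pos (h : ℕ) : 0 < cycLength h := by unfold cycLength; positivity

theorem three_mul_lt_cycLength (h : ℕ) : 3 * (h : ℤ) < cycLength h := by
  unfold cycLength; nlinarith [sq_nonneg (h : ℤ)]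

/-- Every pair of vertices occurs in the sequence. -/
theorem exists_cycEdge_eq {h : ℕ} {e : Finset (RotVertex h)} (he : e.card = 2) :
    ∃ q, cycEdge h q = e := by
  classical
  have hsub : (Finset.Ico 0 (cycLength h)).image (cycEdge h) ⊆
      (Finset.univ : Finset (RotVertex h)).powersetCard 2 := by
    intro f hf
    obtain ⟨q, -, rfl⟩ := Finset.mem_image.1 hf
    exact Finset.mem_powersetCard.2 ⟨Finset.subset_univ _, card_cycEdge h q⟩
  have hinj : Set.InjOn (cycEdge h) (Finset.Ico 0 (cycLength h) : Finset ℤ) := by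
    intro a ha b hb hab
    simp only [Finset.coe_Ico, Set.mem_Ico] at ha hb
    exact eq_of_dvd_sub_of_lt (dvd_of_cycEdge_eq hab) (by omega) (by omega)
  -- One period has (h + 1)(2h + 1) = C(2h + 2, 2) distinct edges, so it exhausts all pairs.
  have hcard : ((Finset.univ : Finset (RotVertex h)).powersetCard 2).card ≤
      ((Finset.Ico 0 (cycLength h)).image (cycEdge h)).card := by
    rw [Finset.card_image_of_injOn hinj, Finset.card_powersetCard, Int.card_Ico, Finset.card_univ,
      Fintype.card_option, ZMod.card, Nat.choose_two_right]
    have : (cycLength h - 0).toNat = (h + 1) * (2 * h + 1) := by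
      unfold cycLength
      rw [sub_zero]
      exact Int.toNat_natCast ((h + 1) * (2 * h + 1))
    rw [this]
    apply le_of_eq
    apply Nat.div_eq_of_eq_mul_right two_pos
    simp only [Nat.add_sub_cancel]
    ring
  have := Finset.eq_of_subset_of_card_le hsub hcard
  have hm : e ∈ (Finset.Ico 0 (cycLength h)).image (cycEdge h) := by
    rw [this]; exact Finset.mem_powersetCard.2 ⟨Finset.subset_univ _, he⟩
  obtain ⟨q, -, hq⟩ := Finset.mem_image.1 hm
  exact ⟨q, hq⟩

/-- Translation of the residues by `t`. -/
def residueShift (h : ℕ) (t : ℤ) : Equiv.Perm (RotVertex h) :=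
  Equiv.optionCongr (Equiv.addRight (t : ZMod (2 * h + 1)))

theorem residueShift_residue (h : ℕ) (t x : ℤ) :
    residueShift h t (residue h x) = residue h (x + t) := by
  simp [residueShift, residue]

theorem cycEdge_map_residueShift (h : ℕ) (t q : ℤ) :
    (cycEdge h q).map (residueShift h t).toEmbedding = cycEdge h (q + t * (h + 1)) := by
  obtain ⟨s, k, h0, h1, rfl⟩ := exists_row_coord h q
  have : s * ((h : ℤ) + 1) + k + t * (h + 1) = (s + t) * ((h : ℤ) + 1) + k := by ring
  rw [this, cycEdge_row h0 h1, cycEdge_row h0 h1]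
  unfold rowEdge
  rw [Finset.map_insert, Finset.map_singleton]
  simp only [Equiv.coe_toEmbedding, residueShift_residue]
  congr 1
  · split_ifs
    · rfl
    · rw [residueShift_residue]; congr 1; ring
  · congr 2; ring

/-! ### Matchings and the action of permutations -/

/-- A set of `r` pairwise disjoint two-element sets. -/
structure IsPairMatching {U : Type*} (r : ℕ) (M : Finset (Finset U)) : Prop where
  card_eq : M.card = r
  card_edge : ∀ e ∈ M, e.card = 2
  disjoint : ∀ e ∈ M, ∀ f ∈ M, e ≠ f → Disjoint e f

namespace IsPairMatching

variable {U : Type*} [DecidableEq U] {r : ℕ} {M M' : Finset (Finset U)}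

theorem exists_param (hM : IsPairMatching r M) :
    ∃ f : Fin r × Fin 2 → U, Function.Injective f ∧
      M = Finset.univ.image (fun k => {f (k, 0), f (k, 1)}) := by
  let en : M ≃ Fin r := M.equivFinOfCardEq hM.card_eq
  have hc : ∀ k : Fin r, ∃ x y, x ≠ y ∧ ((en.symm k : M) : Finset U) = {x, y} := fun k =>
    Finset.card_eq_two.1 (hM.card_edge _ (en.symm k).2)
  choose x y hxy he using hc
  have hmem : ∀ k : Fin r, ∀ i : Fin 2, (if i = 0 then x k else y k) ∈ (en.symm k : Finset U) := by
    intro k i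
    rw [he]
    split_ifs <;> simp
  refine ⟨fun p => if p.2 = 0 then x p.1 else y p.1, ?_, ?_⟩
  · rintro ⟨k, i⟩ ⟨l, j⟩ hkl
    simp only at hkl
    have h1 := hmem k i
    have h2 := hmem l j
    rw [← hkl] at h2
    have hs : ((en.symm k : M) : Finset U) = en.symm l := by
      by_contra hne
      exact Finset.disjoint_left.1
        (hM.disjoint _ (en.symm k).2 _ (en.symm l).2 hne) h1 h2
    have hk : k = l := en.symm.injective (Subtype.ext hs)
    subst hk
    have hx := hxy k
    have : i = j := by
      fin_cases i <;> fin_cases j <;> simp_all [eq_comm]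
    rw [this]
  · ext e
    simp only [Finset.mem_image, Finset.mem_univ, true_and, if_true, Fin.one_eq_zero_iff,
      OfNat.ofNat_ne_one, if_false, ← he]
    constructor
    · intro hm
      exact ⟨en ⟨e, hm⟩, by simp⟩
    · rintro ⟨k, rfl⟩
      exact (en.symm k).2

/-- The 2r endpoints of each matching are numbered injectively, edge by edge; matching up the
numbers gives a partial bijection, which extends to a permutation. -/
theorem exists_perm [Finite U] (hM : IsPairMatching r M) (hM' : IsPairMatching r M') :
    ∃ π : Equiv.Perm U, M.image (fun e => e.map π.toEmbedding) = M' := by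
  classical
  obtain ⟨f, hf, rfl⟩ := hM.exists_param
  obtain ⟨g, hg, rfl⟩ := hM'.exists_param
  let e : {x // x ∈ Set.range f} ≃ {x // x ∈ Set.range g} :=
    (Equiv.ofInjective f hf).symm.trans (Equiv.ofInjective g hg)
  have he : ∀ a, e.extendSubtype (f a) = g a := by
    intro a
    rw [Equiv.extendSubtype_apply_of_mem _ _ ⟨a, rfl⟩]
    have : (Equiv.ofInjective f hf).symm ⟨f a, ⟨a, rfl⟩⟩ = a :=
      Equiv.ofInjective_symm_apply hf a
    simp [e, this]
  refine ⟨e.extendSubtype, ?_⟩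
  rw [Finset.image_image]
  congr 1
  funext k
  simp [Finset.map_insert, he]

end IsPairMatching

/-! ### Windows of the cyclic sequence -/

/-- The edges in positions `q, …, q + r - 1` of the cyclic sequence, relabelled by `σ`. -/
noncomputable def cycWindow {h : ℕ} {U : Type*} [DecidableEq U] (σ : RotVertex h ≃ U) (r : ℕ) (q : ℤ) :
    Finset (Finset U) :=
  (Finset.Ico q (q + r)).image (fun k => (cycEdge h k).map σ.toEmbedding)

section Window

variable {h : ℕ} {U : Type*} [DecidableEq U] {r : ℕ}

theorem mem_cycWindow {σ : RotVertex h ≃ U} {q : ℤ} {e : Finset U} :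
    e ∈ cycWindow σ r q ↔
      ∃ k, q ≤ k ∧ k < q + r ∧ (cycEdge h k).map σ.toEmbedding = e := by
  simp [cycWindow, and_assoc]

theorem isPairMatching_cycWindow (hr : r ≤ h) (σ : RotVertex h ≃ U) (q : ℤ) :
    IsPairMatching r (cycWindow σ r q) := by
  have hd : ∀ a b : ℤ, q ≤ a → a < q + r → q ≤ b → b < q + r → a ≠ b →
      Disjoint ((cycEdge h a).map σ.toEmbedding) ((cycEdge h b).map σ.toEmbedding) := by
    intro a b _ _ _ _ hne
    rw [Finset.disjoint_map]
    rcases lt_or_gt_of_ne hne with hlt | hlt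
    · exact disjoint_cycEdge hlt (by omega)
    · exact (disjoint_cycEdge hlt (by omega)).symm
  refine ⟨?_, ?_, ?_⟩
  · unfold cycWindow
    rw [Finset.card_image_of_injOn, Int.card_Ico]
    · omega
    · intro a ha b hb hab
      by_contra hne
      simp only [Finset.coe_Ico, Set.mem_Ico] at ha hb
      have := hd a b ha.1 ha.2 hb.1 hb.2 hne
      simp only at hab
      rw [hab, disjoint_self, Finset.bot_eq_empty, ← Finset.card_eq_zero, Finset.card_map,
        card_cycEdge] at this
      omega
  · intro e he
    obtain ⟨k, -, -, rfl⟩ := mem_cycWindow.1 he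
    rw [Finset.card_map, card_cycEdge]
  · intro e he f hf hne
    obtain ⟨a, ha, ha', rfl⟩ := mem_cycWindow.1 he
    obtain ⟨b, hb, hb', rfl⟩ := mem_cycWindow.1 hf
    exact hd a b ha ha' hb hb' (fun hab => hne (by rw [hab]))

theorem cycWindow_trans {U' : Type*} [DecidableEq U'] (σ : RotVertex h ≃ U) (π : U ≃ U') (q : ℤ) :
    cycWindow (σ.trans π) r q = (cycWindow σ r q).image (fun e => e.map π.toEmbedding) := by
  unfold cycWindow
  rw [Finset.image_image]
  congr 1
  funext k
  simp only [Function.comp, Finset.map_map]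
  rfl

/-- The number of labellings that put a given matching in a given window depends neither on
the matching nor on the window. -/
theorem exists_card_cycWindow_mem [Fintype U] (hr : r ≤ h) (σ₀ : RotVertex h ≃ U) :
    ∃ K : ℕ, 0 < K ∧ ∀ 𝓐 : Finset (Finset (Finset U)), (∀ M ∈ 𝓐, IsPairMatching r M) → ∀ q : ℤ,
      (Finset.univ.filter (fun σ : RotVertex h ≃ U => cycWindow σ r q ∈ 𝓐)).card =
        𝓐.card * K := by
  classical
  refine ⟨(Finset.univ.filter (fun σ : RotVertex h ≃ U =>
    cycWindow σ r 0 = cycWindow σ₀ r 0)).card, ?_, ?_⟩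
  · exact Finset.card_pos.2 ⟨σ₀, by simp⟩
  · intro 𝓐 h𝓐 q
    rw [Finset.card_eq_sum_card_fiberwise (f := fun σ => cycWindow σ r q) (t := 𝓐)
      (fun σ hσ => by simpa using hσ)]
    refine (Finset.sum_eq_card_nsmul fun M hM => ?_).trans (smul_eq_mul _ _)
    -- Here π changes the target matching and ρ changes the window; composing labellings with both
    -- is a bijection between the two sets being counted.
    obtain ⟨π, hπ⟩ := (h𝓐 M hM).exists_perm (isPairMatching_cycWindow hr σ₀ 0)
    obtain ⟨ρ, hρ⟩ := (isPairMatching_cycWindow (U := RotVertex h) hr (Equiv.refl _) 0).exists_perm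
      (isPairMatching_cycWindow hr (Equiv.refl _) q)
    have hw : ∀ τ : RotVertex h ≃ U, cycWindow (ρ.trans τ) r 0 = cycWindow τ r q := by
      intro τ
      have e1 := cycWindow_trans (r := r) ρ τ 0
      have e2 := cycWindow_trans (r := r) (Equiv.refl (RotVertex h)) ρ 0
      have e3 := cycWindow_trans (r := r) (Equiv.refl (RotVertex h)) τ q
      rw [hρ, Equiv.refl_trans] at e2
      rw [e1, e2, ← e3, Equiv.refl_trans]
    have himg : Function.Injective
        (fun A : Finset (Finset U) => A.image (fun e => e.map π.toEmbedding)) :=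
      Finset.image_injective (Finset.map_injective _)
    refine Finset.card_equiv ((ρ.symm.equivCongr π : (RotVertex h ≃ U) ≃ (RotVertex h ≃ U))) ?_
    intro σ
    have hσ : ρ.symm.equivCongr π σ = (ρ.trans σ).trans π := by
      ext x; simp
    simp only [Finset.mem_filter, Finset.mem_univ, true_and]
    rw [hσ, cycWindow_trans, hw, ← hπ, himg.eq_iff]
    constructor
    · exact fun hh => hh.2
    · exact fun hh => ⟨hh ▸ hM, hh⟩

end Window

/-! ### Intersecting arcs on a cycle -/

/-- Arcs of length `r` on a cycle of length `N ≥ 3 * r - 2` that pairwise meet: there are at most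
`r` of them, and if there are `r` then their starting points are consecutive. -/
theorem intersecting_arcs {N : ℤ} {r : ℕ} {T : ℤ → Prop} [DecidablePred T] (hr : 1 ≤ r)
    (hN : 3 * (r : ℤ) - 2 ≤ N) (hper : ∀ a b, N ∣ a - b → T a → T b)
    (hT : ∀ a b, T a → T b → ∃ d, -(r : ℤ) < d ∧ d < r ∧ N ∣ a - b - d) :
    ((Finset.Ico 0 N).filter T).card ≤ r ∧
      (((Finset.Ico 0 N).filter T).card = r →
        ∃ p, ∀ q, T q ↔ ∃ d, 0 ≤ d ∧ d < (r : ℤ) ∧ N ∣ p - d - q) := by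
  by_cases hex : ∃ q, T q
  swap
  · push Not at hex
    rw [Finset.filter_false_of_mem (fun q _ => hex q)]
    refine ⟨by simp, fun h0 => ?_⟩
    simp at h0
    omega
  obtain ⟨q₀, hq₀⟩ := hex
  -- Every arc meets the one at q₀, so all starting points lift to integer offsets in (-r, r).
  set S := (Finset.Ioo (-(r : ℤ)) r).filter (fun d => T (q₀ + d)) with hS
  have h0S : (0 : ℤ) ∈ S := by
    simp only [hS, Finset.mem_filter, Finset.mem_Ioo, add_zero]
    exact ⟨⟨by omega, by omega⟩, hq₀⟩
  have hlift : ∀ q, T q → ∃ d ∈ S, N ∣ q - q₀ - d := by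
    intro q hq
    obtain ⟨d, h1, h2, h3⟩ := hT q q₀ hq hq₀
    refine ⟨d, ?_, h3⟩
    simp only [hS, Finset.mem_filter, Finset.mem_Ioo]
    refine ⟨⟨h1, h2⟩, hper q _ ?_ hq⟩
    rwa [← sub_sub]
  have hdiff : ∀ d ∈ S, ∀ d' ∈ S, d - d' < r := by
    intro d hd d' hd'
    simp only [hS, Finset.mem_filter, Finset.mem_Ioo] at hd hd'
    obtain ⟨x, h1, h2, h3⟩ := hT _ _ hd.2 hd'.2
    have h4 : N ∣ (d - d') - x := by
      rwa [show q₀ + d - (q₀ + d') = d - d' by ring] at h3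
    -- Since |d - d'| ≤ 2r - 2 and |x| ≤ r - 1, their difference is at most 3r - 3 < N: the
    -- congruence is an equality.
    have := eq_of_dvd_sub_of_lt h4 (by omega) (by omega)
    omega
  have hne : S.Nonempty := ⟨0, h0S⟩
  have hsub : S ⊆ Finset.Ico (S.min' hne) (S.min' hne + r) := by
    intro d hd
    have h1 := S.min'_le d hd
    have h2 := hdiff d hd _ (S.min'_mem hne)
    rw [Finset.mem_Ico]
    omega
  have hScard : S.card ≤ r := by
    have := Finset.card_le_card hsub
    rw [Int.card_Ico] at this
    omega
  have hle : ((Finset.Ico 0 N).filter T).card ≤ S.card := by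
    choose! g hg using hlift
    refine Finset.card_le_card_of_injOn g (fun q hq => (hg q (Finset.mem_filter.1 hq).2).1) ?_
    intro a ha b hb hab
    simp only [Finset.coe_filter, Finset.mem_Ico, Set.mem_ofPred_eq] at ha hb
    have h1 := (hg a ha.2).2
    have h2 := (hg b hb.2).2
    rw [hab] at h1
    have h3 := dvd_sub h1 h2
    rw [show a - q₀ - g b - (b - q₀ - g b) = a - b by ring] at h3
    exact eq_of_dvd_sub_of_lt h3 (by omega) (by omega)
  refine ⟨hle.trans hScard, fun hcard => ?_⟩
  have hSeq : S = Finset.Ico (S.min' hne) (S.min' hne + r) := by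
    refine Finset.eq_of_subset_of_card_le hsub ?_
    rw [Int.card_Ico]
    omega
  refine ⟨q₀ + S.min' hne + r - 1, fun q => ⟨fun hq => ?_, ?_⟩⟩
  · obtain ⟨d, hd, hdvd⟩ := hlift q hq
    have hd' := hd
    rw [hSeq, Finset.mem_Ico] at hd'
    refine ⟨S.min' hne + r - 1 - d, by omega, by omega, ?_⟩
    rw [← dvd_neg] at hdvd
    rwa [show q₀ + S.min' hne + r - 1 - (S.min' hne + r - 1 - d) - q = -(q - q₀ - d) by ring]
  · rintro ⟨d, h1, h2, h3⟩
    have hm : S.min' hne + r - 1 - d ∈ S := by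
      refine (Finset.ext_iff.1 hSeq _).2 ?_
      rw [Finset.mem_Ico]
      omega
    have hTm := (Finset.mem_filter.1 hm).2
    refine hper _ _ ?_ hTm
    rwa [show q₀ + (S.min' hne + r - 1 - d) - q = q₀ + S.min' hne + r - 1 - d - q by ring]

/-! ### Averaging over labellings, and centers -/

section Center

variable {h : ℕ} {U : Type*} [DecidableEq U] {r : ℕ} {𝓐 : Finset (Finset (Finset U))}

theorem cycWindow_congr {σ : RotVertex h ≃ U} {a b : ℤ} (hab : cycLength h ∣ a - b) :
    cycWindow σ r a = cycWindow σ r b := by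
  have key : ∀ a b : ℤ, cycLength h ∣ a - b → cycWindow σ r a ⊆ cycWindow σ r b := by
    intro a b hab e he
    obtain ⟨k, h1, h2, rfl⟩ := mem_cycWindow.1 he
    refine mem_cycWindow.2 ⟨k - a + b, by omega, by omega, ?_⟩
    rw [cycEdge_eq_of_dvd (a := k - a + b) (b := k)]
    rwa [← dvd_neg, show -(k - a + b - k) = a - b by ring]
  exact (key a b hab).antisymm (key b a (by rwa [← dvd_neg, neg_sub]))

theorem exists_dvd_of_cycWindow_meet {σ : RotVertex h ≃ U} {a b : ℤ} {e : Finset U}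
    (ha : e ∈ cycWindow σ r a) (hb : e ∈ cycWindow σ r b) :
    ∃ d, -(r : ℤ) < d ∧ d < r ∧ cycLength h ∣ a - b - d := by
  obtain ⟨k, h1, h2, h3⟩ := mem_cycWindow.1 ha
  obtain ⟨l, h4, h5, h6⟩ := mem_cycWindow.1 hb
  have := dvd_of_cycEdge_eq (Finset.map_injective _ (h3.trans h6.symm))
  refine ⟨(l - b) - (k - a), by omega, by omega, ?_⟩
  rwa [show a - b - (l - b - (k - a)) = k - l by ring]

/-- The windows of the labelled sequence that belong to `𝓐` are those through position `p`. -/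
def IsCenter (𝓐 : Finset (Finset (Finset U))) (r : ℕ) (σ : RotVertex h ≃ U) (p : ℤ) : Prop :=
  ∀ q, cycWindow σ r q ∈ 𝓐 ↔ ∃ d, 0 ≤ d ∧ d < (r : ℤ) ∧ cycLength h ∣ p - d - q

theorem IsCenter.congr {σ : RotVertex h ≃ U} {p p' : ℤ} (hp : IsCenter 𝓐 r σ p)
    (hd : cycLength h ∣ p - p') : IsCenter 𝓐 r σ p' := by
  intro q
  rw [hp q]
  refine exists_congr fun d => and_congr_right fun _ => and_congr_right fun _ => ?_
  rw [← dvd_sub_right hd, show p - p' - (p - d - q) = -(p' - d - q) by ring, dvd_neg]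

theorem IsCenter.mem {σ : RotVertex h ≃ U} {p q : ℤ} (hp : IsCenter 𝓐 r σ p) (h1 : p - r < q)
    (h2 : q ≤ p) : cycWindow σ r q ∈ 𝓐 :=
  (hp q).2 ⟨p - q, by omega, by omega, by simp⟩

theorem card_windows_le (hr : 1 ≤ r) (hrh : r ≤ h)
    (hI : ∀ M ∈ 𝓐, ∀ M' ∈ 𝓐, ∃ e ∈ M, e ∈ M') (σ : RotVertex h ≃ U) :
    ((Finset.Ico 0 (cycLength h)).filter (fun q => cycWindow σ r q ∈ 𝓐)).card ≤ r ∧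
    (((Finset.Ico 0 (cycLength h)).filter (fun q => cycWindow σ r q ∈ 𝓐)).card = r →
      ∃ p, IsCenter 𝓐 r σ p) := by
  refine intersecting_arcs hr ?_ ?_ ?_
  · have := three_mul_lt_cycLength h
    omega
  · intro a b hab ha
    rwa [← cycWindow_congr hab]
  · intro a b ha hb
    obtain ⟨e, h1, h2⟩ := hI _ ha _ hb
    exact exists_dvd_of_cycWindow_meet h1 h2

/-- The edge x occupies a position p of the labelled cycle, and the r windows starting at p - d with
0 ≤ d < r contain it. This spares computing the size of a star. -/
theorem le_card_windows_star (hrh : r ≤ h) {x : Finset U} (hx : x.card = 2)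
    {𝓢 : Finset (Finset (Finset U))} (h𝓢 : ∀ M, M ∈ 𝓢 ↔ IsPairMatching r M ∧ x ∈ M)
    (σ : RotVertex h ≃ U) :
    r ≤ ((Finset.Ico 0 (cycLength h)).filter (fun q => cycWindow σ r q ∈ 𝓢)).card := by
  obtain ⟨p, hp⟩ := exists_cycEdge_eq (h := h) (e := x.map σ.symm.toEmbedding) (by simpa using hx)
  have hp' : (cycEdge h p).map σ.toEmbedding = x := by
    rw [hp, Finset.map_map]
    ext y
    simp
  have hN := three_mul_lt_cycLength h
  have hpos := cycLength_pos h
  have hinj : Set.InjOn (fun d : ℕ => (p - d) % cycLength h) (Finset.range r : Finset ℕ) := by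
    intro a ha b hb hab
    simp only [Finset.coe_range, Set.mem_Iio] at ha hb
    have hd : cycLength h ∣ (p - a) - (p - b) := (Int.emod_eq_emod_iff_emod_sub_eq_zero.1 hab) |>
      Int.dvd_of_emod_eq_zero
    have := eq_of_dvd_sub_of_lt hd (by omega) (by omega)
    omega
  calc r = ((Finset.range r).image (fun d : ℕ => (p - d) % cycLength h)).card := by
        rw [Finset.card_image_of_injOn hinj, Finset.card_range]
    _ ≤ _ := by
        refine Finset.card_le_card fun q hq => ?_
        obtain ⟨d, hd, rfl⟩ := Finset.mem_image.1 hq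
        rw [Finset.mem_range] at hd
        rw [Finset.mem_filter, Finset.mem_Ico]
        refine ⟨⟨Int.emod_nonneg _ hpos.ne', Int.emod_lt_of_pos _ hpos⟩, ?_⟩
        rw [h𝓢]
        refine ⟨isPairMatching_cycWindow hrh _ _, ?_⟩
        have hc : cycLength h ∣ (p - d) % cycLength h - (p - d) := by
          rw [← dvd_neg, neg_sub]
          exact Int.dvd_self_sub_emod
        rw [cycWindow_congr hc]
        exact mem_cycWindow.2 ⟨p, by omega, by omega, hp'⟩

theorem cycWindow_residueShift (σ : RotVertex h ≃ U) (t q : ℤ) :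
    cycWindow ((residueShift h t).trans σ) r q = cycWindow σ r (q + t * (h + 1)) := by
  ext e
  rw [mem_cycWindow, mem_cycWindow]
  have hmap : ∀ k, (cycEdge h k).map ((residueShift h t).trans σ).toEmbedding =
      (cycEdge h (k + t * (h + 1))).map σ.toEmbedding := by
    intro k
    rw [← cycEdge_map_residueShift, Finset.map_map]
    rfl
  constructor
  · rintro ⟨k, h1, h2, h3⟩
    exact ⟨k + t * (h + 1), by omega, by omega, by rw [← hmap, h3]⟩
  · rintro ⟨k, h1, h2, h3⟩
    exact ⟨k - t * (h + 1), by omega, by omega, by rw [hmap, sub_add_cancel, h3]⟩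

theorem IsCenter.residueShift {σ : RotVertex h ≃ U} {p t : ℤ}
    (hp : IsCenter 𝓐 r σ (p + t * (h + 1))) :
    IsCenter 𝓐 r ((residueShift h t).trans σ) p := by
  intro q
  rw [cycWindow_residueShift, hp]
  simp only [show ∀ d, p + t * ((h : ℤ) + 1) - d - (q + t * (h + 1)) = p - d - q by
    intro d; ring]

variable [Fintype U]

theorem sum_card_windows {K : ℕ}
    (hK : ∀ q : ℤ, (Finset.univ.filter (fun σ : RotVertex h ≃ U => cycWindow σ r q ∈ 𝓐)).card =
        𝓐.card * K) :
    ∑ σ : RotVertex h ≃ U,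
      ((Finset.Ico 0 (cycLength h)).filter (fun q => cycWindow σ r q ∈ 𝓐)).card =
      (cycLength h).toNat * (𝓐.card * K) := by
  have := Finset.sum_card_bipartiteAbove_eq_sum_card_bipartiteBelow
    (s := (Finset.univ : Finset (RotVertex h ≃ U))) (t := Finset.Ico 0 (cycLength h))
    (fun σ q => cycWindow σ r q ∈ 𝓐)
  unfold Finset.bipartiteAbove Finset.bipartiteBelow at this
  rw [this, Finset.sum_congr rfl (fun q _ => hK q), Finset.sum_const, Int.card_Ico, sub_zero,
    smul_eq_mul]

/-- An intersecting family of matchings is no larger than a star. If it is as large as a star,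
every labelling has a center. -/
theorem card_le_star_and_center (hr : 1 ≤ r) (hrh : r ≤ h) (σ₀ : RotVertex h ≃ U)
    (hM : ∀ M ∈ 𝓐, IsPairMatching r M)
    (hI : ∀ M ∈ 𝓐, ∀ M' ∈ 𝓐, ∃ e ∈ M, e ∈ M') {x : Finset U} (hx : x.card = 2)
    {𝓢 : Finset (Finset (Finset U))} (h𝓢 : ∀ M, M ∈ 𝓢 ↔ IsPairMatching r M ∧ x ∈ M) :
    𝓐.card ≤ 𝓢.card ∧
      (𝓢.card ≤ 𝓐.card → ∀ σ : RotVertex h ≃ U, ∃ p, IsCenter 𝓐 r σ p) := by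
  obtain ⟨K, hK0, hK⟩ := exists_card_cycWindow_mem hrh σ₀
  have sA := sum_card_windows (hK 𝓐 hM)
  have sS := sum_card_windows (hK 𝓢 (fun M hm => ((h𝓢 M).1 hm).1))
  have hNpos : 0 < (cycLength h).toNat := by
    have := cycLength_pos h
    omega
  -- The comparison through r holds labelling by labelling, so equal totals force exactly r windows
  -- for each labelling.
  have hle : ∀ σ : RotVertex h ≃ U, _ := fun σ =>
    (card_windows_le hr hrh hI σ).1.trans (le_card_windows_star hrh hx h𝓢 σ)
  constructor
  · have := Finset.sum_le_sum (s := Finset.univ) (fun σ _ => hle σ)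
    rw [sA, sS] at this
    exact Nat.le_of_mul_le_mul_right (Nat.le_of_mul_le_mul_left this hNpos) hK0
  · intro hge σ
    refine (card_windows_le hr hrh hI σ).2 ?_
    have hsum : ∑ σ : RotVertex h ≃ U,
        ((Finset.Ico 0 (cycLength h)).filter (fun q => cycWindow σ r q ∈ 𝓐)).card =
        ∑ σ : RotVertex h ≃ U,
        ((Finset.Ico 0 (cycLength h)).filter (fun q => cycWindow σ r q ∈ 𝓢)).card := by
      refine le_antisymm (Finset.sum_le_sum fun σ _ => hle σ) ?_
      rw [sA, sS]
      gcongr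
    have heq := (Finset.sum_eq_sum_iff_of_le (fun σ _ => hle σ)).1 hsum σ (Finset.mem_univ _)
    refine le_antisymm (card_windows_le hr hrh hI σ).1 ?_
    rw [heq]
    exact le_card_windows_star hrh hx h𝓢 σ

/-- As many labellings have their window at q in the family as at q + 1. So if one loses membership
from q to q + 1, another gains it, and its r consecutive windows start at q + 1 and end at q + r. -/
theorem exists_center_add (hrh : r ≤ h) (hM : ∀ M ∈ 𝓐, IsPairMatching r M)
    (hr : 1 ≤ r) (hall : ∀ σ : RotVertex h ≃ U, ∃ p, IsCenter 𝓐 r σ p)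
    {σ : RotVertex h ≃ U} {q : ℤ} (hq : IsCenter 𝓐 r σ q) :
    ∃ σ' : RotVertex h ≃ U, IsCenter 𝓐 r σ' (q + r) := by
  classical
  obtain ⟨K, -, hK⟩ := exists_card_cycWindow_mem hrh σ
  have hN := three_mul_lt_cycLength h
  have hcard := Finset.card_sdiff_comm ((hK 𝓐 hM q).trans (hK 𝓐 hM (q + 1)).symm)
  have hσ : σ ∈ Finset.univ.filter (fun σ : RotVertex h ≃ U => cycWindow σ r q ∈ 𝓐) \
      Finset.univ.filter (fun σ : RotVertex h ≃ U => cycWindow σ r (q + 1) ∈ 𝓐) := by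
    simp only [Finset.mem_sdiff, Finset.mem_filter, Finset.mem_univ, true_and]
    refine ⟨hq.mem (by omega) le_rfl, fun hm => ?_⟩
    obtain ⟨d, h1, h2, h3⟩ := (hq _).1 hm
    have := eq_of_dvd_sub_of_lt h3 (by omega) (by omega)
    omega
  have hpos := Finset.card_pos.2 ⟨σ, hσ⟩
  rw [hcard] at hpos
  obtain ⟨σ', hσ'⟩ := Finset.card_pos.1 hpos
  simp only [Finset.mem_sdiff, Finset.mem_filter, Finset.mem_univ, true_and] at hσ'
  obtain ⟨p, hp⟩ := hall σ'
  refine ⟨σ', hp.congr ?_⟩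
  obtain ⟨d, h1, h2, h3⟩ := (hp _).1 hσ'.1
  have hd : d = r - 1 := by
    by_contra hne
    refine hσ'.2 ((hp q).2 ⟨d + 1, by omega, by omega, ?_⟩)
    rwa [show p - (d + 1) - q = p - d - (q + 1) by ring]
  subst hd
  rwa [show p - (q + r) = p - (r - 1) - (q + 1) by ring]

/-- Some labelling has its center so early in a perfect matching that the window starting there
stays inside this perfect matching. -/
theorem exists_early_center (hrh : r ≤ h) (hM : ∀ M ∈ 𝓐, IsPairMatching r M)
    (hr : 1 ≤ r) (σ₀ : RotVertex h ≃ U) (hall : ∀ σ : RotVertex h ≃ U, ∃ p, IsCenter 𝓐 r σ p) :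
    ∃ (σ : RotVertex h ≃ U) (i : ℤ), 0 ≤ i ∧ i + r ≤ h ∧ IsCenter 𝓐 r σ i := by
  have step : ∀ k : ℕ, k ≤ h → (∃ σ : RotVertex h ≃ U, IsCenter 𝓐 r σ k) →
      ∃ (σ : RotVertex h ≃ U) (i : ℤ), 0 ≤ i ∧ i + r ≤ h ∧ IsCenter 𝓐 r σ i := by
    intro k
    induction k using Nat.strong_induction_on with
    | _ k ih =>
      rintro hk ⟨σ, hσ⟩
      by_cases hc : k + r ≤ h
      · exact ⟨σ, k, by omega, by omega, hσ⟩
      · obtain ⟨σ', hσ'⟩ := exists_center_add hrh hM hr hall hσ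
        -- A translation brings the center k + r back to the first row, at a position smaller than k
        -- because r ≤ h.
        refine ih (k + r - (h + 1)) (by omega) (by omega) ⟨(residueShift h 1).trans σ', ?_⟩
        apply IsCenter.residueShift
        convert hσ' using 1
        omega
  obtain ⟨p, hp⟩ := hall σ₀
  obtain ⟨t, k, h0, h1, rfl⟩ := exists_row_coord h p
  refine step k.toNat (by omega) ⟨(residueShift h t).trans σ₀, ?_⟩
  apply IsCenter.residueShift
  convert hp using 1
  rw [Int.toNat_of_nonneg h0]
  ring

end Center

/-! ### Transpositions of adjacent residues -/

/-- The transposition of the consecutive residues `-j` and `-j + 1`. -/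
def residueSwap (h : ℕ) (j : ℤ) : Equiv.Perm (RotVertex h) :=
  Equiv.swap (residue h (-j)) (residue h (-j + 1))

section Swap

variable {h : ℕ} {j : ℤ}

theorem Finset.map_swap_eq_self {α : Type*} [DecidableEq α] {e : Finset α} {a b : α}
    (ha : a ∉ e) (hb : b ∉ e) : e.map (Equiv.swap a b).toEmbedding = e := by
  have : ∀ x ∈ e, Equiv.swap a b x = x := fun x hx =>
    Equiv.swap_apply_of_ne_of_ne (fun h => ha (h ▸ hx)) (fun h => hb (h ▸ hx))
  ext y
  simp only [Finset.mem_map, Equiv.coe_toEmbedding]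
  exact ⟨fun ⟨x, hx, hxy⟩ => hxy ▸ (this x hx).symm ▸ hx, fun hy => ⟨y, hy, this y hy⟩⟩

theorem Finset.map_swap_map_swap {α : Type*} [DecidableEq α] (e : Finset α) (a b : α) :
    (e.map (Equiv.swap a b).toEmbedding).map (Equiv.swap a b).toEmbedding = e := by
  rw [Finset.map_map]
  ext y
  simp

theorem residue_notMem_rowEdge {t k x : ℤ} (h1 : ¬ (2 * (h : ℤ) + 1) ∣ x - (t + k))
    (h2 : ¬ (2 * (h : ℤ) + 1) ∣ x - (t - k)) : residue h x ∉ rowEdge h t k := by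
  unfold rowEdge
  simp only [Finset.mem_insert, Finset.mem_singleton, not_or]
  refine ⟨?_, by rwa [residue_eq_iff]⟩
  split_ifs
  · exact residue_ne_none
  · rwa [residue_eq_iff]

theorem none_mem_rowEdge {t k : ℤ} : none ∈ rowEdge h t k ↔ k = 0 := by
  unfold rowEdge
  by_cases hk : k = 0 <;> simp [hk, residue]

theorem not_dvd_of_lt {m x : ℤ} (hx : x ≠ 0) (h1 : x < m) (h2 : -x < m) : ¬ m ∣ x := fun hd =>
  hx (Int.eq_zero_of_abs_lt_dvd hd (abs_lt.2 ⟨by omega, h1⟩))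

theorem cycEdge_neg_row {a : ℤ} (h0 : -((h : ℤ) + 1) ≤ a) (h1 : a < 0) :
    cycEdge h a = rowEdge h (-1) (a + (h + 1)) := by
  rw [← cycEdge_row (by omega) (by omega)]
  congr 1
  ring

/-- The transposition fixes `h` consecutive edges. -/
theorem cycEdge_map_residueSwap (hj2 : 2 ≤ j) (hjh : j ≤ h + 1) {k : ℤ} (h1 : j - h - 1 ≤ k)
    (h2 : k ≤ j - 2) : (cycEdge h k).map (residueSwap h j).toEmbedding = cycEdge h k := by
  unfold residueSwap
  -- The residues -j and -j + 1 are avoided by the edges up to j - 2 in row 0, and by those from j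
  -- on in row -1.
  by_cases hk : 0 ≤ k
  · rw [cycEdge_zero_row hk (by omega)]
    apply Finset.map_swap_eq_self <;> apply residue_notMem_rowEdge <;> apply not_dvd_of_lt <;> omega
  · rw [cycEdge_neg_row (by omega) (by omega)]
    apply Finset.map_swap_eq_self <;> apply residue_notMem_rowEdge <;> apply not_dvd_of_lt <;> omega

/-- An edge that the transposition moves changes the sum of its ends by one. -/
theorem dvd_of_rowEdge_map_residueSwap {t k s l : ℤ} (hk0 : 0 < k) (hk : k ≤ h) (hl0 : 0 < l)
    (hl : l ≤ h) (e : (rowEdge h t k).map (residueSwap h j).toEmbedding = rowEdge h s l)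
    (hne : rowEdge h t k ≠ rowEdge h s l) :
    (2 * (h : ℤ) + 1) ∣ 2 * (s - t) - 1 ∨ (2 * (h : ℤ) + 1) ∣ 2 * (s - t) + 1 := by
  -- The default value at infinity never matters: edges with k, l > 0 have only finite ends.
  let g : RotVertex h → ZMod (2 * h + 1) := fun x => x.getD 0
  have hg : ∀ x : ℤ, g (residue h x) = x := fun x => rfl
  have ends : ∀ t k : ℤ, 0 < k → rowEdge h t k = {residue h (t + k), residue h (t - k)} := by
    intro t k hk
    rw [rowEdge, if_neg hk.ne']
  have ends_ne : ∀ t k : ℤ, 0 < k → k ≤ h → residue h (t + k) ≠ residue h (t - k) := by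
    intro t k h0 h1
    have := rowEdge_ends_ne (t := t) h0.le h1
    rwa [if_neg h0.ne'] at this
  have hsum : g (residueSwap h j (residue h (t + k))) + g (residueSwap h j (residue h (t - k))) =
      ((2 * s : ℤ) : ZMod (2 * h + 1)) := by
    have h1 : ∑ x ∈ (rowEdge h t k).map (residueSwap h j).toEmbedding, g x =
        ∑ x ∈ rowEdge h s l, g x := by rw [e]
    rw [Finset.sum_map, ends t k hk0, ends s l hl0, Finset.sum_pair (ends_ne t k hk0 hk),
      Finset.sum_pair (ends_ne s l hl0 hl), hg, hg] at h1
    simp only [Equiv.coe_toEmbedding] at h1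
    rw [h1]
    push_cast
    ring
  have hdvd : ∀ c : ℤ, ((2 * t + c : ℤ) : ZMod (2 * h + 1)) = ((2 * s : ℤ) : ZMod (2 * h + 1)) →
      (2 * (h : ℤ) + 1) ∣ 2 * (s - t) - c := by
    intro c hc
    rw [ZMod.intCast_eq_intCast_iff_dvd_sub] at hc
    push_cast at hc
    rwa [show 2 * (s - t) - c = 2 * s - (2 * t + c) by ring]
  have hE := ends_ne t k hk0 hk
  have hval : ∀ x y : ℤ, residue h x = residue h y → (x : ZMod (2 * h + 1)) = y := fun x y hxy =>
    Option.some_inj.1 hxy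
  have hv1 := hval (t + k)
  have hv2 := hval (t - k)
  rw [ends t k hk0, Finset.map_insert, Finset.map_singleton] at e
  rw [ends t k hk0] at hne
  simp only [Equiv.coe_toEmbedding] at e
  unfold residueSwap at e hsum
  by_cases a1 : residue h (t + k) = residue h (-j)
  · by_cases b2 : residue h (t - k) = residue h (-j + 1)
    -- If both ends are swapped, the edge is unchanged.
    · rw [a1, b2, Equiv.swap_apply_left, Equiv.swap_apply_right, ← a1, ← b2, Finset.pair_comm] at e
      exact absurd e hne
    · rw [Equiv.swap_apply_of_ne_of_ne (a1 ▸ hE.symm) b2, a1, Equiv.swap_apply_left, hg, hg] at hsum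
      have := hv1 _ a1
      refine Or.inl (hdvd 1 ?_)
      rw [← hsum]
      push_cast at this ⊢
      linear_combination this
  · by_cases a2 : residue h (t + k) = residue h (-j + 1)
    · by_cases b1 : residue h (t - k) = residue h (-j)
      · rw [a2, b1, Equiv.swap_apply_left, Equiv.swap_apply_right, ← a2, ← b1,
          Finset.pair_comm] at e
        exact absurd e hne
      · rw [Equiv.swap_apply_of_ne_of_ne b1 (a2 ▸ hE.symm), a2, Equiv.swap_apply_right, hg,
          hg] at hsum
        have := hv1 _ a2
        right
        rw [← sub_neg_eq_add]
        refine hdvd (-1) ?_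
        rw [← hsum]
        push_cast at this ⊢
        linear_combination this
    · rw [Equiv.swap_apply_of_ne_of_ne a1 a2] at hsum e
      by_cases b1 : residue h (t - k) = residue h (-j)
      · rw [b1, Equiv.swap_apply_left, hg, hg] at hsum
        have := hv2 _ b1
        refine Or.inl (hdvd 1 ?_)
        rw [← hsum]
        push_cast at this ⊢
        linear_combination this
      · by_cases b2 : residue h (t - k) = residue h (-j + 1)
        · rw [b2, Equiv.swap_apply_right, hg, hg] at hsum
          have := hv2 _ b2
          right
          rw [← sub_neg_eq_add]
          refine hdvd (-1) ?_
          rw [← hsum]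
          push_cast at this ⊢
          linear_combination this
        · rw [Equiv.swap_apply_of_ne_of_ne b1 b2] at e
          exact absurd e hne

theorem none_mem_map_residueSwap {e : Finset (RotVertex h)} :
    none ∈ e.map (residueSwap h j).toEmbedding ↔ none ∈ e := by
  have : residueSwap h j none = none :=
    Equiv.swap_apply_of_ne_of_ne residue_ne_none.symm residue_ne_none.symm
  conv_lhs => rw [← this]
  exact Finset.mem_map' _

/-- The transposition never carries an edge to a different edge that is close in the sequence. -/
theorem cycEdge_map_residueSwap_ne {a b : ℤ} (hh : 2 ≤ h) (hj2 : 2 ≤ j) (hjh : j ≤ h + 1)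
    (haj : a ≤ j - 2) (hbj : j - h - 1 ≤ b) (hab : a < b) (hN : b - a < cycLength h)
    (ha : -(2 * (h : ℤ) + 2) < a) (hb : b < 2 * h + 2)
    (hrow : b < h + 1 ∨ -((h : ℤ) + 1) < a) (hfar : a < -((h : ℤ) + 1) ∨ h + 1 < b → 3 ≤ h) :
    (cycEdge h a).map (residueSwap h j).toEmbedding ≠ cycEdge h b := by
  intro e
  have hne : cycEdge h a ≠ cycEdge h b := fun hc => by
    have := eq_of_dvd_sub_of_lt (dvd_of_cycEdge_eq hc) (by omega) (by omega)
    omega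
  have ha' : a < j - h - 1 := by
    by_contra hc
    rw [cycEdge_map_residueSwap hj2 hjh (by omega) haj] at e
    exact hne e
  have hb' : j - 2 < b := by
    by_contra hc
    have := Finset.map_swap_map_swap (cycEdge h a) (residue h (-j)) (residue h (-j + 1))
    change ((cycEdge h a).map (residueSwap h j).toEmbedding).map (residueSwap h j).toEmbedding = _
      at this
    rw [e, cycEdge_map_residueSwap hj2 hjh hbj (by omega)] at this
    exact hne this.symm
  have hnone : none ∈ cycEdge h a ↔ none ∈ cycEdge h b := by
    rw [← e, none_mem_map_residueSwap]
  obtain ⟨t, k, hk0, hk, ht, hak⟩ : ∃ t k : ℤ, 0 ≤ k ∧ k ≤ h ∧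
      ((t = -1 ∧ a = k - (h + 1)) ∨ (t = -2 ∧ a = k - 2 * (h + 1))) ∧
      a = t * ((h : ℤ) + 1) + k := by
    by_cases hc : -((h : ℤ) + 1) ≤ a
    · exact ⟨-1, a + (h + 1), by omega, by omega, by omega, by ring⟩
    · exact ⟨-2, a + 2 * (h + 1), by omega, by omega, by omega, by ring⟩
  obtain ⟨s, l, hl0, hl, hs, hbl⟩ : ∃ s l : ℤ, 0 ≤ l ∧ l ≤ h ∧
      ((s = 0 ∧ b = l) ∨ (s = 1 ∧ b = l + (h + 1))) ∧ b = s * ((h : ℤ) + 1) + l := by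
    by_cases hc : b < h + 1
    · exact ⟨0, b, by omega, by omega, by omega, by ring⟩
    · exact ⟨1, b - (h + 1), by omega, by omega, by omega, by ring⟩
  rw [hak, hbl, cycEdge_row hk0 hk, cycEdge_row hl0 hl] at e hne hnone
  rw [none_mem_rowEdge, none_mem_rowEdge] at hnone
  have hk1 : 0 < k := by omega
  have hl1 : 0 < l := by omega
  -- Now s - t is 1 or 2, and 2 only when h ≥ 3, so 2(s - t) ± 1 lies strictly between 0 and 2h + 1.
  rcases dvd_of_rowEdge_map_residueSwap hk1 hk hl1 hl e hne with hd | hd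
  · have := Int.le_of_dvd (by omega) hd
    omega
  · have := Int.le_of_dvd (by omega) hd
    omega

end Swap

theorem map_perm_trans {h : ℕ} {U : Type*} (σ : RotVertex h ≃ U) (π : Equiv.Perm (RotVertex h))
    (e : Finset (RotVertex h)) :
    e.map (π.trans σ).toEmbedding = (e.map π.toEmbedding).map σ.toEmbedding := by
  rw [Finset.map_map]
  rfl

/-! ### Stability of an early center -/

section Center

variable {h : ℕ} {U : Type*} [DecidableEq U] {r : ℕ} {𝓐 : Finset (Finset (Finset U))}

/-- A window of fixed edges through i stays in the family, so the new center is close to i. Were it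
different, a window ending at one center and a window starting at the other, one from each
labelling, would share an edge, which `cycEdge_map_residueSwap_ne` forbids. -/
theorem IsCenter.trans_residueSwap (hI : ∀ M ∈ 𝓐, ∀ M' ∈ 𝓐, ∃ e ∈ M, e ∈ M')
    (hall : ∀ σ : RotVertex h ≃ U, ∃ p, IsCenter 𝓐 r σ p) {σ : RotVertex h ≃ U} {i j : ℤ}
    (hr : 2 ≤ r) (hi : 0 ≤ i) (hir : i + r ≤ h) (hij : i + 2 ≤ j) (hjh : j ≤ h + 1)
    (hc : IsCenter 𝓐 r σ i) : IsCenter 𝓐 r ((residueSwap h j).trans σ) i := by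
  have hN := three_mul_lt_cycLength h
  -- The earliest window of fixed edges through i is taken: a new center beyond i then forces s = j
  -- - h - 1 ≤ 0, which bounds the positions compared below.
  obtain ⟨s, hs1, hs2, hs3, hs4, hs5⟩ : ∃ s : ℤ, j - h - 1 ≤ s ∧ s + r - 1 ≤ j - 2 ∧ s ≤ i ∧
      i ≤ s + r - 1 ∧ (s = i - r + 1 ∨ s = j - h - 1) := by
    rcases le_total (i - r + 1) (j - h - 1) with hle | hle
    · exact ⟨j - h - 1, by omega, by omega, by omega, by omega, by omega⟩
    · exact ⟨i - r + 1, by omega, by omega, by omega, by omega, by omega⟩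
  have hwin : cycWindow ((residueSwap h j).trans σ) r s = cycWindow σ r s := by
    unfold cycWindow
    refine Finset.image_congr fun k hk => ?_
    simp only [Finset.coe_Ico, Set.mem_Ico] at hk
    rw [map_perm_trans, cycEdge_map_residueSwap (by omega) hjh (by omega) (by omega)]
  obtain ⟨p₀, hp₀⟩ := hall ((residueSwap h j).trans σ)
  obtain ⟨d, hd0, hdr, hd⟩ := (hp₀ s).1 (hwin ▸ hc.mem (by omega) hs3)
  have hp := hp₀.congr (p' := s + d) (by rwa [show p₀ - (s + d) = p₀ - d - s by ring])
  set p := s + d with hpdef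
  rcases lt_trichotomy p i with hlt | heq | hgt
  · exfalso
    obtain ⟨e, he1, he2⟩ := hI _ (hp.mem (q := p - r + 1) (by omega) (by omega)) _
      (hc.mem (q := i) (by omega) le_rfl)
    obtain ⟨a, ha1, ha2, rfl⟩ := mem_cycWindow.1 he1
    obtain ⟨b, hb1, hb2, hab⟩ := mem_cycWindow.1 he2
    rw [map_perm_trans] at hab
    exact cycEdge_map_residueSwap_ne (by omega) (by omega) hjh (by omega) (by omega) (by omega)
      (by omega) (by omega) (by omega) (by omega) (by omega)
      (Finset.map_injective _ hab).symm
  · rwa [← heq]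
  · exfalso
    obtain ⟨e, he1, he2⟩ := hI _ (hc.mem (q := i - r + 1) (by omega) (by omega)) _
      (hp.mem (q := p) (by omega) le_rfl)
    obtain ⟨a, ha1, ha2, rfl⟩ := mem_cycWindow.1 he1
    obtain ⟨b, hb1, hb2, hab⟩ := mem_cycWindow.1 he2
    rw [map_perm_trans] at hab
    have hba := Finset.map_injective _ hab
    refine cycEdge_map_residueSwap_ne (a := a) (b := b) (by omega) (by omega) hjh (by omega)
      (by omega) (by omega) (by omega) (by omega) (by omega) (by omega) (by omega) ?_
    rw [← hba]
    exact Finset.map_swap_map_swap _ _ _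

theorem IsCenter.swap_last (hI : ∀ M ∈ 𝓐, ∀ M' ∈ 𝓐, ∃ e ∈ M, e ∈ M')
    (hall : ∀ σ : RotVertex h ≃ U, ∃ p, IsCenter 𝓐 r σ p) {i : ℤ} (hr : 2 ≤ r) (hi : 0 ≤ i)
    (hir : i + r ≤ h) (m : ℕ) :
    ∀ {σ : RotVertex h ≃ U}, i < h - m → IsCenter 𝓐 r σ i →
      IsCenter 𝓐 r ((Equiv.swap (residue h (-(h - m))) (residue h (-(h + 1)))).trans σ) i := by
  induction m with
  | zero =>
    intro σ hm hc
    have := hc.trans_residueSwap hI hall (j := h + 1) hr hi hir (by omega) le_rfl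
    rwa [residueSwap, Equiv.swap_comm,
      show (-((h : ℤ) + 1) + 1) = -(h - (0 : ℕ)) by push_cast; ring] at this
  | succ m ih =>
    intro σ hm hc
    push_cast at hm
    -- Conjugation by an adjacent swap moves the exchanged residue one step further from -(h + 1).
    have hconj : Equiv.swap (residue h (-(h - (m + 1 : ℕ)))) (residue h (-(h + 1))) =
        residueSwap h (h - m) * Equiv.swap (residue h (-(h - m))) (residue h (-(h + 1))) *
          residueSwap h (h - m) := by
      have hz : -((h : ℤ) - m) + 1 = -(h - (m + 1 : ℕ)) := by push_cast; ring
      rw [residueSwap, hz, Equiv.swap_comm (residue h (-(h - m))) (residue h (-(h + 1))),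
        Equiv.swap_mul_swap_mul_swap]
      · intro he
        have := eq_of_residue_eq he (by omega) (by omega)
        omega
      · intro he
        have := eq_of_residue_eq he (by push_cast; omega) (by push_cast; omega)
        push_cast at this
        omega
    rw [hconj, Equiv.Perm.mul_def, Equiv.Perm.mul_def, Equiv.trans_assoc, Equiv.trans_assoc]
    have step : ∀ {τ : RotVertex h ≃ U}, IsCenter 𝓐 r τ i →
        IsCenter 𝓐 r ((residueSwap h (h - m)).trans τ) i := fun hτ =>
      hτ.trans_residueSwap hI hall hr hi hir (by omega) (by omega)
    exact step (ih (by omega) (step hc))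

/-- Every member of `𝓐` contains the edge at an early center. -/
theorem IsCenter.edge_mem (hM : ∀ M ∈ 𝓐, IsPairMatching r M)
    (hI : ∀ M ∈ 𝓐, ∀ M' ∈ 𝓐, ∃ e ∈ M, e ∈ M')
    (hall : ∀ σ : RotVertex h ≃ U, ∃ p, IsCenter 𝓐 r σ p) {σ : RotVertex h ≃ U} {i : ℤ}
    (hr : 1 ≤ r) (hi : 0 ≤ i) (hir : i + r ≤ h) (hc : IsCenter 𝓐 r σ i)
    {M : Finset (Finset U)} (hMA : M ∈ 𝓐) : (cycEdge h i).map σ.toEmbedding ∈ M := by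
  by_contra hx
  let bad : (RotVertex h ≃ U) → Finset ℤ := fun σ =>
    (Finset.Ico i (i + r)).filter (fun k => (cycEdge h k).map σ.toEmbedding ∈ M)
  -- Induction on the number of edges of the window at i that lie in M.
  suffices H : ∀ c : ℕ, ∀ σ : RotVertex h ≃ U, (bad σ).card = c → IsCenter 𝓐 r σ i →
      (cycEdge h i).map σ.toEmbedding ∉ M → False from H _ σ rfl hc hx
  intro c
  induction c using Nat.strong_induction_on with
  | _ c ih =>
    intro σ hcard hc hx
    obtain ⟨e, he1, he2⟩ := hI _ (hc.mem (q := i) (by omega) le_rfl) _ hMA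
    obtain ⟨k, hk1, hk2, rfl⟩ := mem_cycWindow.1 he1
    have hki : k ≠ i := by
      rintro rfl
      exact hx he2
    -- Modulo 2h + 1, -(h + 1) is h, an end of the edge at position h ≥ i + r outside the window. So
    -- τ replaces {k, -k} by {k, h} and fixes the rest of the window.
    set τ := Equiv.swap (residue h (-k)) (residue h (-(h + 1))) with hτ
    have hcτ : IsCenter 𝓐 r (τ.trans σ) i := by
      have := hc.swap_last hI hall (by omega) hi hir (h - k).toNat (by omega)
      rwa [Int.toNat_of_nonneg (by omega), sub_sub_cancel] at this
    have hfix : ∀ l, i ≤ l → l < i + r → l ≠ k →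
        (cycEdge h l).map (τ.trans σ).toEmbedding = (cycEdge h l).map σ.toEmbedding := by
      intro l h1 h2 h3
      rw [map_perm_trans, cycEdge_zero_row (by omega) (by omega)]
      congr 1
      apply Finset.map_swap_eq_self <;> apply residue_notMem_rowEdge <;> apply not_dvd_of_lt <;>
        omega
    have hgood : (cycEdge h k).map (τ.trans σ).toEmbedding ∉ M := by
      intro hmem
      have hkr : cycEdge h k = {residue h k, residue h (-k)} := by
        rw [cycEdge_zero_row (by omega) (by omega), rowEdge, if_neg (by omega), zero_add, zero_sub]
      have hτk : τ (residue h k) = residue h k := by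
        refine Equiv.swap_apply_of_ne_of_ne ?_ ?_ <;> intro he <;>
          have := eq_of_residue_eq he (by omega) (by omega) <;> omega
      have h1 : σ (residue h k) ∈ (cycEdge h k).map σ.toEmbedding := by simp [hkr]
      have h2 : σ (residue h k) ∈ (cycEdge h k).map (τ.trans σ).toEmbedding := by
        rw [map_perm_trans, hkr, Finset.map_insert]
        simp [hτk]
      -- The old and new edges share the image of k but differ, so the matching M cannot contain
      -- both.
      by_cases heq : (cycEdge h k).map σ.toEmbedding = (cycEdge h k).map (τ.trans σ).toEmbedding
      · rw [map_perm_trans] at heq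
        have heq' := Finset.map_injective _ heq
        have h3 : residue h (-(h + 1)) ∈ cycEdge h k := by
          rw [heq', hkr, Finset.map_insert, Finset.map_singleton]
          simp [hτ]
        rw [cycEdge_zero_row (by omega) (by omega)] at h3
        refine residue_notMem_rowEdge ?_ ?_ h3 <;> apply not_dvd_of_lt <;> omega
      · exact Finset.disjoint_left.1 ((hM M hMA).disjoint _ he2 _ hmem heq) h1 h2
    refine ih (bad (τ.trans σ)).card ?_ (τ.trans σ) rfl hcτ ?_
    · rw [← hcard]
      refine Finset.card_lt_card (Finset.ssubset_iff_of_subset ?_ |>.2 ⟨k, ?_, ?_⟩)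
      · intro l hl
        simp only [bad, Finset.mem_filter, Finset.mem_Ico] at hl ⊢
        refine ⟨hl.1, ?_⟩
        rw [← hfix l hl.1.1 hl.1.2 (by rintro rfl; exact hgood hl.2)]
        exact hl.2
      · simp only [bad, Finset.mem_filter, Finset.mem_Ico]
        exact ⟨⟨hk1, hk2⟩, he2⟩
      · simp only [bad, Finset.mem_filter, not_and]
        exact fun _ => hgood
    · rwa [hfix i le_rfl (by omega) hki.symm]

end Center

/-! ### Translation to the Kneser graph -/

section Kneser

variable {m r : ℕ}

/-- The underlying family of subsets of a set of vertices of a Kneser graph. -/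
def toPairs (s : Finset {A : Finset (Fin m) // A.card = 2}) : Finset (Finset (Fin m)) :=
  s.map (Function.Embedding.subtype _)

theorem toPairs_injective : Function.Injective (toPairs (m := m)) := Finset.map_injective _

theorem mem_toPairs {s : Finset {A : Finset (Fin m) // A.card = 2}}
    {v : {A : Finset (Fin m) // A.card = 2}} : v.1 ∈ toPairs s ↔ v ∈ s :=
  Finset.mem_map' (Function.Embedding.subtype _)

theorem exists_of_mem_toPairs {s : Finset {A : Finset (Fin m) // A.card = 2}}
    {e : Finset (Fin m)} (he : e ∈ toPairs s) : ∃ v ∈ s, v.1 = e := by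
  simpa [toPairs] using he

theorem exists_toPairs_eq {M : Finset (Finset (Fin m))} (hM : ∀ e ∈ M, e.card = 2) :
    ∃ s, toPairs s = M :=
  ⟨M.subtype _, by rw [toPairs, Finset.subtype_map, Finset.filter_true_of_mem hM]⟩

/-- The independent sets of the complement of `K(m, 2)` are the matchings. -/
theorem mem_indepSetFinset_compl_kneserGraph {s : Finset {A : Finset (Fin m) // A.card = 2}} :
    s ∈ (kneserGraph m 2)ᶜ.indepSetFinset r ↔ IsPairMatching r (toPairs s) := by
  rw [SimpleGraph.mem_indepSetFinset_iff, SimpleGraph.isNIndepSet_iff]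
  have hcard : (toPairs s).card = s.card := Finset.card_map _
  have hadj : ∀ v w : {A : Finset (Fin m) // A.card = 2}, v ≠ w →
      (¬ (kneserGraph m 2)ᶜ.Adj v w ↔ Disjoint v.1 w.1) := by
    intro v w hvw
    rw [SimpleGraph.compl_adj]
    simp [kneserGraph, hvw]
  constructor
  · rintro ⟨hs, hc⟩
    refine ⟨hcard.trans hc, ?_, ?_⟩
    · intro e he
      obtain ⟨v, -, rfl⟩ := exists_of_mem_toPairs he
      exact v.2
    · intro e he f hf hne
      obtain ⟨v, hv, rfl⟩ := exists_of_mem_toPairs he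
      obtain ⟨w, hw, rfl⟩ := exists_of_mem_toPairs hf
      have hvw : v ≠ w := fun h => hne (by rw [h])
      exact (hadj v w hvw).1 (hs hv hw hvw)
  · intro hs
    refine ⟨fun v hv w hw hvw => (hadj v w hvw).2 ?_, hcard.symm.trans hs.card_eq⟩
    exact hs.disjoint _ (mem_toPairs.2 hv) _ (mem_toPairs.2 hw) (fun h => hvw (Subtype.ext h))

theorem mem_image_indepStar {v : {A : Finset (Fin m) // A.card = 2}}
    {M : Finset (Finset (Fin m))} :
    M ∈ ((kneserGraph m 2)ᶜ.indepStar r v).image toPairs ↔ IsPairMatching r M ∧ v.1 ∈ M := by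
  simp only [Finset.mem_image, SimpleGraph.indepStar, Finset.mem_filter,
    mem_indepSetFinset_compl_kneserGraph]
  constructor
  · rintro ⟨s, ⟨h1, h2⟩, rfl⟩
    exact ⟨h1, mem_toPairs.2 h2⟩
  · rintro ⟨h1, h2⟩
    obtain ⟨s, rfl⟩ := exists_toPairs_eq h1.card_edge
    exact ⟨s, ⟨h1, mem_toPairs.1 h2⟩, rfl⟩

theorem isIntersectingIndepFamily_indepStar (v : {A : Finset (Fin m) // A.card = 2}) :
    (kneserGraph m 2)ᶜ.IsIntersectingIndepFamily r ((kneserGraph m 2)ᶜ.indepStar r v) := by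
  refine ⟨Finset.filter_subset _ _, fun s hs t ht => ?_⟩
  rw [Finset.disjoint_left]
  exact fun h => h (Finset.mem_filter.1 hs).2 (Finset.mem_filter.1 ht).2

end Kneser

theorem mainTheorem3 (n r : ℕ) (hr : r < n) :
    (kneserGraph (2 * n) 2)ᶜ.IndepIsStrictlyEKR r := by
  obtain ⟨h, rfl⟩ : ∃ h, n = h + 1 := ⟨n - 1, by omega⟩
  have hrh : r ≤ h := by omega
  obtain ⟨v₀⟩ : Nonempty {A : Finset (Fin (2 * (h + 1))) // A.card = 2} := by
    obtain ⟨s, -, hs⟩ := Finset.exists_subset_card_eq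
      (s := (Finset.univ : Finset (Fin (2 * (h + 1))))) (n := 2) (by simp)
    exact ⟨⟨s, hs⟩⟩
  -- For r = 0 the empty set does not meet itself, so the only intersecting family is empty, and so
  -- is every star.
  rcases Nat.eq_zero_or_pos r with rfl | hr1
  · have hempty : ∀ A, (kneserGraph (2 * (h + 1)) 2)ᶜ.IsIntersectingIndepFamily 0 A → A = ∅ := by
      rintro A ⟨hA, hI⟩
      refine Finset.eq_empty_of_forall_notMem fun s hs => hI hs hs ?_
      have := (SimpleGraph.mem_indepSetFinset_iff.1 (hA hs)).card_eq
      rw [Finset.card_eq_zero.1 this]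
      exact Finset.disjoint_empty_left _
    refine ⟨fun A hA => by simp [hempty A hA], fun A hA _ => ⟨v₀, ?_⟩⟩
    rw [hempty A hA, hempty _ (isIntersectingIndepFamily_indepStar v₀)]
  have σ₀ : RotVertex h ≃ Fin (2 * (h + 1)) := Fintype.equivOfCardEq (by
    rw [Fintype.card_option, ZMod.card, Fintype.card_fin]
    ring)
  have hmatch : ∀ A, (kneserGraph (2 * (h + 1)) 2)ᶜ.IsIntersectingIndepFamily r A →
      ∀ M ∈ A.image toPairs, IsPairMatching r M := by
    rintro A ⟨hA, -⟩ M hM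
    obtain ⟨s, hs, rfl⟩ := Finset.mem_image.1 hM
    exact mem_indepSetFinset_compl_kneserGraph.1 (hA hs)
  have hinter : ∀ A, (kneserGraph (2 * (h + 1)) 2)ᶜ.IsIntersectingIndepFamily r A →
      ∀ M ∈ A.image toPairs, ∀ M' ∈ A.image toPairs, ∃ e ∈ M, e ∈ M' := by
    rintro A ⟨-, hI⟩ M hM M' hM'
    obtain ⟨s, hs, rfl⟩ := Finset.mem_image.1 hM
    obtain ⟨t, ht, rfl⟩ := Finset.mem_image.1 hM'
    obtain ⟨v, hv, hv'⟩ := Finset.not_disjoint_iff.1 (hI hs ht)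
    exact ⟨v.1, mem_toPairs.2 hv, mem_toPairs.2 hv'⟩
  have hmain : ∀ A, (kneserGraph (2 * (h + 1)) 2)ᶜ.IsIntersectingIndepFamily r A →
      ∀ v, _ := fun A hA v =>
    card_le_star_and_center hr1 hrh σ₀ (hmatch A hA) (hinter A hA) v.2
      (fun M => mem_image_indepStar (v := v))
  simp only [Finset.card_image_of_injective _ toPairs_injective] at hmain
  refine ⟨fun A hA => (hmain A hA v₀).1.trans
    (Finset.le_sup (f := fun v => ((kneserGraph (2 * (h + 1)) 2)ᶜ.indepStar r v).card)
      (Finset.mem_univ v₀)), fun A hA hmax => ?_⟩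
  have hall := (hmain A hA v₀).2 (hmax _ (isIntersectingIndepFamily_indepStar v₀))
  obtain ⟨σ, i, hi, hir, hc⟩ := exists_early_center hrh (hmatch A hA) hr1 σ₀ hall
  let v : {A : Finset (Fin (2 * (h + 1))) // A.card = 2} :=
    ⟨(cycEdge h i).map σ.toEmbedding, by rw [Finset.card_map, card_cycEdge]⟩
  -- The star at v is itself intersecting, so maximality turns the inclusion into an equality.
  refine ⟨v, Finset.eq_of_subset_of_card_le (fun s hs => ?_)
    (hmax _ (isIntersectingIndepFamily_indepStar v))⟩
  refine Finset.mem_filter.2 ⟨hA.1 hs, mem_toPairs.1 ?_⟩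
  exact hc.edge_mem (hmatch A hA) (hinter A hA) hall hr1 hi hir (Finset.mem_image_of_mem _ hs)
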